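/- Let $d$ be a quasi-distance on a set $X$: $d$ is symmetric and nonnegative, $d(x,y)=0$ iff $x=y$, and $d(x,y)\le\kappa(d(x,z)+d(z,y))$ for some constant $\kappa\ge1$. Let $\mu$ be a positive measure on a $\sigma$-algebra containing the balls $B(x,r)=\{y:d(x,y)<r\}$, such that for some $A>0$ we have $0<\mu(B(x,2r))\le A\,\mu(B(x,r))<\infty$ for all $x\in X$, $r>0$ (that is, $(X,d,\mu)$ is a space of homogeneous type). Assume that $\mu(\{x\})=0$ for every $x\in X$ and $\mu(X)=\infty$. Let $\mathcal D=\bigcup_{j\in\mathbb Z}\mathcal D_j$ be a dyadic family on $X$, meaning: (i) for some $0<\nu<1$ and constants $0<c,C<\infty$, every $Q\in\mathcal D_j$ satisfies $c\,\nu^j\le\operatorname{diam}Q\le C\nu^j$ and $c\le\operatorname{ecc}Q\le C$, where $\operatorname{ecc}Q=\sup\{r_1/r_2: B(x_1,r_1)\subseteq Q\subseteq B(x_2,r_2),\ r_1,r_2>0\}$; (ii) every $Q\in\mathcal D$ is measurable; (iii) each $\mathcal D_j$ is a partition of $X$ into nonempty sets; (iv) every $Q\in\mathcal D_{j+1}$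 is contained in exactly one cube of $\mathcal D_j$; (v) for some $M$, every $Q\in\mathcal D_j$ has at least $1$ and at most $M$ offspring, i.e. cubes $Q'\in\mathcal D_{j+1}$ with $Q'\subseteq Q$; (vi) any two cubes of $\mathcal D$ are disjoint or nested; (vii) for each $Q\in\mathcal D$, the union of the cubes of $\mathcal D$ containing $Q$ is $X$. Let $\mathscr H=\bigcup_{Q\in\mathcal D}\mathscr H(Q)$ be a Haar system associated to $\mathcal D$ in the real space $L^2(X,\mu)$: for each cube $Q$ of level $j$, $\mathscr H(Q)$ together with $\chi_Q/\sqrt{\mu(Q)}$ is an orthonormal basis of the space of functions that vanish outside $Q$ and are constant on each offspring of $Q$ ($\mathscr H(Q)=\emptyset$ if $Q$ has only one offspring). Let $\delta(x,x)=0$ and $\delta(x,y)=\inf\{\mu(Q):Q\in\mathcal D,\ x,y\in Q\}$ for $x\ne y$. For $\sigma>0$ and $u\in L^2(X,\mu)$ put $$\mathscr E^{d,\mu}_\sigma(u)=\iint_{X\times X}\frac{|u(x)-u(y)|^2}{\mu(B(x,d(x,y)))^{1+2\sigma}}\,d\mu(x)d\mu(y),\qquad \mathscr E^{\delta,\mu}_\sigma(u)=\iint_{X\times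 X}\frac{|u(x)-u(y)|^2}{\delta(x,y)^{1+2\sigma}}\,d\mu(x)d\mu(y),$$ with values in $[0,\infty]$ and integrands $0$ on the diagonal, and let $H^\sigma_{d,\mu}$, resp. $H^\sigma_{\delta,\mu}$, be the set of $u\in L^2(X,\mu)$ with $\mathscr E^{d,\mu}_\sigma(u)<\infty$, resp. $\mathscr E^{\delta,\mu}_\sigma(u)<\infty$. For $\lambda>0$ let $\Pi_\lambda$ be the orthogonal projection of $L^2(X,\mu)$ onto the closed linear span of all $h\in\mathscr H(Q)$, $Q\in\mathcal D$, with $\mu(Q)>\lambda$. Then for every $\sigma>0$ and every $\lambda>0$ there is a constant $C(\lambda)>0$ (which may depend also on $\sigma$, the space, the dyadic family and the Haar system, but not on $u$) such that $$\mathscr E^{d,\mu}_\sigma(u)\ \ge\ C(\lambda)\,\|u\|_{L^2(X,\mu)}^2\qquad\text{for every }u\in H^\sigma_{\delta,\mu}\text{ with }\Pi_\lambda u=0 .$$ Moreover $H^\sigma_{d,\mu}\cap H^\sigma_{\delta,\mu}\cap\operatorname{Ker}\Pi_\lambda$ is a space of coercivity for $\mathscr E^{d,\mu}_\sigma$: it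 is a linear subspace of $H^\sigma_{d,\mu}$, it is complete for the norm $\|u\|_{L^2}+\sqrt{\mathscr E^{d,\mu}_\sigma(u)}$, and for some $c>0$ all its elements satisfy $\mathscr E^{d,\mu}_\sigma(u)\ge c\|u\|^2_{L^2}$. -/

import Mathlib

open MeasureTheory Filter Topology
open scoped ENNReal

noncomputable section

namespace HomogeneousType

variable {X : Type*}

/-- The open ball `B(x,r) = {y : d(x,y) < r}`. -/
def qball (d : X → X → ℝ) (x : X) (r : ℝ) : Set X := {y | d x y < r}

/-- A quasi-distance on `X`. -/
structure IsQuasiDistance (d : X → X → ℝ) : Prop where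
  symm : ∀ x y, d x y = d y x
  nonneg : ∀ x y, 0 ≤ d x y
  eq_zero_iff : ∀ x y, d x y = 0 ↔ x = y
  quasi_triangle : ∃ κ : ℝ, 1 ≤ κ ∧ ∀ x y z, d x y ≤ κ * (d x z + d z y)

/-- `(X,d,μ)` is a space of homogeneous type: `d` is a quasi-distance, the `σ`-algebra on which `μ`
is defined contains the `d`-balls, and `μ` is doubling. -/
structure IsHomogeneousType [MeasurableSpace X] (d : X → X → ℝ) (μ : Measure X) : Prop where
  quasiDistance : IsQuasiDistance d
  measurableSet_qball : ∀ x r, MeasurableSet (qball d x r)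
  doubling : ∃ A : ℝ, 0 < A ∧ ∀ x r, 0 < r →
    0 < μ (qball d x (2 * r)) ∧
    μ (qball d x (2 * r)) ≤ ENNReal.ofReal A * μ (qball d x r) ∧
    ENNReal.ofReal A * μ (qball d x r) < ∞

/-- `diam Q = sup {d(x,y) : x, y ∈ Q}`. -/
def qdiam (d : X → X → ℝ) (Q : Set X) : ℝ≥0∞ :=
  ⨆ (x ∈ Q) (y ∈ Q), ENNReal.ofReal (d x y)

/-- The eccentricity of `Q`: the supremum of the ratios `r₁ / r₂` over all balls
`B(x₁,r₁) ⊆ Q` and `B(x₂,r₂) ⊇ Q`. -/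
def eccentricity (d : X → X → ℝ) (Q : Set X) : ℝ≥0∞ :=
  ⨆ (x₁ : X) (r₁ : ℝ) (x₂ : X) (r₂ : ℝ) (_ : 0 < r₁) (_ : 0 < r₂)
    (_ : qball d x₁ r₁ ⊆ Q) (_ : Q ⊆ qball d x₂ r₂), ENNReal.ofReal (r₁ / r₂)

/-- The offspring of a cube `Q` of level `j`: the cubes of level `j + 1` contained in `Q`. -/
def offspring (D : ℤ → Set (Set X)) (j : ℤ) (Q : Set X) : Set (Set X) :=
  {Q' | Q' ∈ D (j + 1) ∧ Q' ⊆ Q}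

/-- `D` is a dyadic family on `X`; `D j` is the collection of the cubes of level `j`. -/
structure IsDyadicFamily [MeasurableSpace X] (d : X → X → ℝ) (D : ℤ → Set (Set X)) : Prop where
  /-- cubes of level `j` have diameter comparable to `ν ^ j` and eccentricity comparable to `1` -/
  size : ∃ ν c C : ℝ, 0 < ν ∧ ν < 1 ∧ 0 < c ∧ 0 < C ∧ ∀ j, ∀ Q ∈ D j,
    ENNReal.ofReal (c * ν ^ j) ≤ qdiam d Q ∧ qdiam d Q ≤ ENNReal.ofReal (C * ν ^ j) ∧
    ENNReal.ofReal c ≤ eccentricity d Q ∧ eccentricity d Q ≤ ENNReal.ofReal C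
  measurableSet : ∀ j, ∀ Q ∈ D j, MeasurableSet Q
  partition : ∀ j, Setoid.IsPartition (D j)
  parent : ∀ j, ∀ Q ∈ D (j + 1), ∃! P, P ∈ D j ∧ Q ⊆ P
  offspring_card : ∃ M : ℕ, ∀ j, ∀ Q ∈ D j,
    1 ≤ (offspring D j Q).encard ∧ (offspring D j Q).encard ≤ M
  nested : ∀ i j, ∀ P ∈ D i, ∀ Q ∈ D j, P ∩ Q = ∅ ∨ P ⊆ Q ∨ Q ⊆ P
  /-- `X` is a quadrant: the cubes containing a given cube exhaust `X` -/
  quadrant : ∀ j, ∀ Q ∈ D j, (⋃ (i : ℤ) (P ∈ D i) (_ : Q ⊆ P), P) = Set.univ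

section Haar

variable [MeasurableSpace X] (μ : Measure X)

/-- The functions in `L²` that vanish outside `Q` and are constant on each offspring of the cube
`Q` of level `j` (as usual in `L²`, up to null sets). -/
def cubeFunctions (D : ℤ → Set (Set X)) (j : ℤ) (Q : Set X) : Set (Lp ℝ 2 μ) :=
  {f | (∀ᵐ x ∂μ, x ∉ Q → f x = 0) ∧
    ∀ Q' ∈ offspring D j Q, ∃ a : ℝ, ∀ᵐ x ∂μ, x ∈ Q' → f x = a}

/-- `H` is a Haar system associated to `D`: for each cube `Q` of level `j`, the normalized indicator
`e = χ_Q / √μ(Q)` together with the elements of `H j Q` is an orthonormal basis of the space of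
functions supported in `Q` and constant on the offspring of `Q`.  (If `Q` has only one offspring
this forces `H j Q = ∅`, so a set that occurs as a cube of several levels carries Haar functions
for at most one of them.) -/
def IsHaarSystem (D : ℤ → Set (Set X)) (H : ℤ → Set X → Set (Lp ℝ 2 μ)) : Prop :=
  ∀ j, ∀ Q ∈ D j, ∃ e : Lp ℝ 2 μ,
    e =ᵐ[μ] Q.indicator (fun _ => (Real.sqrt (μ.real Q))⁻¹) ∧
    e ∉ H j Q ∧
    Orthonormal ℝ (Subtype.val : ↥(insert e (H j Q)) → Lp ℝ 2 μ) ∧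
    (Submodule.span ℝ (insert e (H j Q)) : Set (Lp ℝ 2 μ)) = cubeFunctions μ D j Q

variable {μ}

/-- `M_l`: the closed linear span in `L²` of the Haar functions based on cubes of measure
greater than `l`. -/
def haarSpan (D : ℤ → Set (Set X)) (H : ℤ → Set X → Set (Lp ℝ 2 μ)) (l : ℝ) :
    Submodule ℝ (Lp ℝ 2 μ) :=
  (Submodule.span ℝ
    {h | ∃ j, ∃ Q ∈ D j, ENNReal.ofReal l < μ Q ∧ h ∈ H j Q}).topologicalClosure

/-- `Π_l`: the orthogonal projection of `L²` onto `M_l`. -/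
def haarProj (D : ℤ → Set (Set X)) (H : ℤ → Set X → Set (Lp ℝ 2 μ)) (l : ℝ) :
    Lp ℝ 2 μ →L[ℝ] Lp ℝ 2 μ :=
  haveI : CompleteSpace (haarSpan D H l) :=
    (Submodule.isClosed_topologicalClosure _).completeSpace_coe
  (haarSpan D H l).starProjection

end Haar

section Energy

variable [MeasurableSpace X] (μ : Measure X)

/-- `μ(B(x,d(x,y)))`. -/
def ballMeasure (d : X → X → ℝ) (x y : X) : ℝ≥0∞ := μ (qball d x (d x y))

open Classical in
/-- The dyadic distance `δ(x,y)`: zero on the diagonal and otherwise the infimum of `μ(Q)` over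
the dyadic cubes `Q` containing both `x` and `y`. -/
def dyadicDist (D : ℤ → Set (Set X)) (x y : X) : ℝ≥0∞ :=
  if x = y then 0 else ⨅ (j : ℤ) (Q ∈ D j) (_ : x ∈ Q) (_ : y ∈ Q), μ Q

/-- `∬ |u(x) - u(y)|² / w(x,y)^(1+2σ) dμ(x) dμ(y)`, with values in `[0,∞]`.  On the diagonal the
integrand is `0 / 0 = 0`. -/
def energy (w : X → X → ℝ≥0∞) (σ : ℝ) (u : X → ℝ) : ℝ≥0∞ :=
  ∫⁻ p : X × X, ‖u p.1 - u p.2‖ₑ ^ 2 / w p.1 p.2 ^ (1 + 2 * σ) ∂(μ.prod μ)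

/-- The generalized energy, with `w(x,y) = μ(B(x,d(x,y)))`. -/
def energyQ (d : X → X → ℝ) (σ : ℝ) (u : X → ℝ) : ℝ≥0∞ :=
  energy μ (ballMeasure μ d) σ u

/-- The dyadic energy, with `w(x,y) = δ(x,y)`. -/
def energyDyadic (D : ℤ → Set (Set X)) (σ : ℝ) (u : X → ℝ) : ℝ≥0∞ :=
  energy μ (dyadicDist μ D) σ u

/-- `H^σ_{d,μ}`: the functions in `L²` with finite generalized energy. -/
def sobolevQ (d : X → X → ℝ) (σ : ℝ) : Set (Lp ℝ 2 μ) := {u | energyQ μ d σ u < ∞}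

/-- `H^σ_{δ,μ}`: the functions in `L²` with finite dyadic energy. -/
def sobolevDyadic (D : ℤ → Set (Set X)) (σ : ℝ) : Set (Lp ℝ 2 μ) :=
  {u | energyDyadic μ D σ u < ∞}

variable {μ}

/-- The norm `‖u‖_{L²} + √(energy of u)` of `H^σ_{d,μ}`, with values in `[0,∞]`. -/
def sobolevNorm (d : X → X → ℝ) (σ : ℝ) (u : Lp ℝ 2 μ) : ℝ≥0∞ :=
  ‖u‖ₑ + energyQ μ d σ u ^ (1 / 2 : ℝ)

/-- `W` is a space of coercivity for the generalized energy: a linear subspace of `H^σ_{d,μ}`,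
complete for the norm of `H^σ_{d,μ}`, on which the energy dominates a positive multiple of the
square of the `L²` norm. -/
structure IsCoercivitySpace (d : X → X → ℝ) (σ : ℝ) (W : Set (Lp ℝ 2 μ)) : Prop where
  linear : ∃ S : Submodule ℝ (Lp ℝ 2 μ), (S : Set (Lp ℝ 2 μ)) = W
  subset : W ⊆ sobolevQ μ d σ
  complete : ∀ f : ℕ → Lp ℝ 2 μ, (∀ n, f n ∈ W) →
    (∀ ε : ℝ≥0∞, 0 < ε → ∃ N, ∀ m ≥ N, ∀ n ≥ N, sobolevNorm d σ (f m - f n) < ε) →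
    ∃ u ∈ W, Tendsto (fun n => sobolevNorm d σ (f n - u)) atTop (𝓝 0)
  coercive : ∃ c : ℝ, 0 < c ∧ ∀ u ∈ W, ENNReal.ofReal (c * ‖u‖ ^ 2) ≤ energyQ μ d σ u

end Energy

end HomogeneousType

end

/-!
The dyadic cubes are comparable to balls, so `μ(B(x, d(x,y))) ≤ K μ(Q)` whenever a cube `Q` contains
`x` and `y` (`HasDyadicScales.exists_ballMeasure_le`); in particular `μ(B(x, d(x,y))) ≤ K δ(x,y)`
and the generalized energy dominates the dyadic one.

Let `Π_l u = 0`.  On a cube of measure greater than `l`, orthogonality to the Haar functions says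
that `u` has the same average on the cube and on its offspring.  Hence its averages over all the
ancestors agree, and they vanish because `u ∈ L²` and the ancestors have unbounded measure
(`setIntegral_cubeAt_succ_eq_zero`).  Thus `u` has mean zero on every cube `Q` of measure at most
`l` whose parent has measure greater than `l`.  As points are null and `μ(X) = ∞`, these cubes
partition `X`.  On each of them the mean-zero property gives
`μ(Q) ∫_Q |u|² ≤ ∬_{Q×Q} |u(x) - u(y)|²`, and the weight on `Q × Q` is at most `K μ(Q)`, so the
energy on `Q × Q` is at least a constant times `l ^ (-2σ) ∫_Q |u|²`
(`setLIntegral_sq_le_energy_on`).  Summing over the partition gives the coercivity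
(`HasDyadicScales.exists_energyQ_ge`).

For linearity and completeness, `(x, y) ↦ μ(B(x, d(x,y)))` need not be measurable on `X × X`, so
that the energy is only a lower integral, for which neither additivity nor Fatou's lemma is
available.  The weight is therefore compared with a measurable one built from the cubes,
`cubeWeight`, for which the triangle inequality and Fatou's lemma hold; both properties are then
carried back by the comparison.
-/

namespace HomogeneousType

variable {X : Type*}

/-! ### Quantitative geometry of the cubes -/

/-- The quantitative content of the axioms on sizes: the quasi-triangle inequality holds with
constant `κ`, each cube of level `j` contains a ball of radius `ρ * ν ^ j` centred at one of its
points, and its diameter is at most `C * ν ^ j`. -/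
structure HasDyadicScales (d : X → X → ℝ) (D : ℤ → Set (Set X)) (κ ν ρ C : ℝ) : Prop where
  one_le : 1 ≤ κ
  triangle : ∀ x y z, d x y ≤ κ * (d x z + d z y)
  ν_pos : 0 < ν
  ν_lt_one : ν < 1
  ρ_pos : 0 < ρ
  C_pos : 0 < C
  inner_ball : ∀ j, ∀ Q ∈ D j, ∃ x ∈ Q, qball d x (ρ * ν ^ j) ⊆ Q
  dist_le : ∀ j, ∀ Q ∈ D j, ∀ x ∈ Q, ∀ y ∈ Q, d x y ≤ C * ν ^ j

theorem IsDyadicFamily.exists_scales [MeasurableSpace X] {d : X → X → ℝ} {D : ℤ → Set (Set X)}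
    (hd : IsQuasiDistance d) (hD : IsDyadicFamily d D) :
    ∃ κ ν ρ C : ℝ, HasDyadicScales d D κ ν ρ C := by
  obtain ⟨κ, hκ, htri⟩ := hd.quasi_triangle
  obtain ⟨ν, c, C, hν, hν1, hc, hC, hsize⟩ := hD.size
  have hκ0 : 0 < κ := by linarith
  refine ⟨κ, ν, c ^ 2 / (4 * κ), C, hκ, htri, hν, hν1, by positivity, hC, ?_, ?_⟩
  · intro j Q hQ
    obtain ⟨h1, -, h3, -⟩ := hsize j Q hQ
    have hlt : ENNReal.ofReal (c / 2) < eccentricity d Q :=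
      lt_of_lt_of_le ((ENNReal.ofReal_lt_ofReal_iff hc).2 (by linarith)) h3
    simp only [eccentricity, lt_iSup_iff] at hlt
    obtain ⟨x₁, r₁, x₂, r₂, hr₁, hr₂, hB₁, hB₂, hlt⟩ := hlt
    have hx₁ : x₁ ∈ Q := hB₁ (by simpa [qball, (hd.eq_zero_iff x₁ x₁).2 rfl] using hr₁)
    refine ⟨x₁, hx₁, fun y hy => hB₁ ?_⟩
    have hratio : c / 2 * r₂ < r₁ := by
      have := (ENNReal.ofReal_lt_ofReal_iff (by positivity)).1 hlt
      rwa [lt_div_iff₀ hr₂] at this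
    have hdiam : c * ν ^ j ≤ 2 * κ * r₂ := by
      refine (ENNReal.ofReal_le_ofReal_iff (by positivity)).1 (h1.trans ?_)
      refine iSup₂_le fun x hx => iSup₂_le fun y hy => ENNReal.ofReal_le_ofReal ?_
      have hx' : d x₂ x < r₂ := hB₂ hx
      have hy' : d x₂ y < r₂ := hB₂ hy
      have := htri x y x₂
      rw [hd.symm x x₂] at this
      nlinarith
    have hy : d x₁ y < c ^ 2 / (4 * κ) * ν ^ j := hy
    refine lt_of_lt_of_le hy ?_
    have : c ^ 2 / (4 * κ) * ν ^ j = c / (4 * κ) * (c * ν ^ j) := by ring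
    rw [this]
    calc c / (4 * κ) * (c * ν ^ j) ≤ c / (4 * κ) * (2 * κ * r₂) := by gcongr
      _ = c / 2 * r₂ := by field_simp; ring
      _ ≤ r₁ := hratio.le
  · intro j Q hQ x hx y hy
    refine (ENNReal.ofReal_le_ofReal_iff (by positivity)).1 (le_trans ?_ (hsize j Q hQ).2.1)
    exact le_iSup₂_of_le x hx (le_iSup₂_of_le y hy le_rfl)

theorem qball_mono {d : X → X → ℝ} (x : X) {r s : ℝ} (h : r ≤ s) :
    qball d x r ⊆ qball d x s :=
  fun _ hy => lt_of_lt_of_le hy h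

theorem HasDyadicScales.subset_qball {d : X → X → ℝ} {D : ℤ → Set (Set X)} {κ ν ρ C : ℝ}
    (hS : HasDyadicScales d D κ ν ρ C) {j : ℤ}
    {Q : Set X}
    (hQ : Q ∈ D j) {x : X} (hx : x ∈ Q) : Q ⊆ qball d x (2 * C * ν ^ j) := by
  intro y hy
  have := hS.dist_le j Q hQ x hx y hy
  have h : 0 < C * ν ^ j := mul_pos hS.C_pos (zpow_pos hS.ν_pos j)
  show d x y < _
  linarith

section Measure

variable [MeasurableSpace X] {d : X → X → ℝ} {μ : Measure X} {D : ℤ → Set (Set X)}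
  {κ ν ρ C : ℝ}

theorem IsHomogeneousType.measure_qball_lt_top (hX : IsHomogeneousType d μ) (x : X) {r : ℝ}
    (hr : 0 < r) : μ (qball d x r) < ∞ := by
  obtain ⟨A, -, h⟩ := hX.doubling
  have h' := h x (r / 2) (by positivity)
  have h2 : 2 * (r / 2) = r := by ring
  rw [h2] at h'
  exact h'.2.1.trans_lt h'.2.2

theorem IsHomogeneousType.measure_qball_pos (hX : IsHomogeneousType d μ) (x : X) {r : ℝ}
    (hr : 0 < r) : 0 < μ (qball d x r) := by
  obtain ⟨A, -, h⟩ := hX.doubling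
  have h' := h x (r / 2) (by positivity)
  have h2 : 2 * (r / 2) = r := by ring
  rw [h2] at h'
  exact h'.1

/-- Iterated doubling: dilating a ball by a fixed factor multiplies its measure by a bounded
factor. -/
theorem IsHomogeneousType.exists_dilation (hX : IsHomogeneousType d μ) (t : ℝ) :
    ∃ K : ℝ≥0∞, K ≠ 0 ∧ K ≠ ∞ ∧
      ∀ x r, 0 < r → μ (qball d x (t * r)) ≤ K * μ (qball d x r) := by
  obtain ⟨A, hA, h⟩ := hX.doubling
  obtain ⟨n, hn⟩ := pow_unbounded_of_one_lt t (one_lt_two : (1 : ℝ) < 2)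
  refine ⟨ENNReal.ofReal A ^ n, by simp [hA], by simp, fun x r hr => ?_⟩
  have hpow : ∀ n : ℕ, μ (qball d x (2 ^ n * r)) ≤ ENNReal.ofReal A ^ n * μ (qball d x r) := by
    intro n
    induction n with
    | zero => simp
    | succ n ih =>
      have := (h x (2 ^ n * r) (by positivity)).2.1
      rw [pow_succ', mul_assoc, pow_succ', mul_assoc]
      exact this.trans (by gcongr)
  exact (measure_mono (qball_mono x (by gcongr))).trans (hpow n)

theorem IsHomogeneousType.sigmaFinite (hX : IsHomogeneousType d μ) : SigmaFinite μ := by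
  rcases isEmpty_or_nonempty X with hE | ⟨⟨x⟩⟩
  · rw [Measure.eq_zero_of_isEmpty μ]; infer_instance
  refine ⟨⟨⟨fun n : ℕ => qball d x (n + 1), fun _ => trivial,
    fun n => hX.measure_qball_lt_top x (by positivity), ?_⟩⟩⟩
  refine Set.eq_univ_of_forall fun y => Set.mem_iUnion.2 ?_
  obtain ⟨n, hn⟩ := exists_nat_gt (d x y)
  exact ⟨n, show d x y < n + 1 by linarith⟩

/-- A ball of radius comparable to `ν ^ j` centred in a cube of level `j` has measure at most a
constant times that of the cube. -/
theorem HasDyadicScales.exists_measure_qball_le (hS : HasDyadicScales d D κ ν ρ C)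
    (hX : IsHomogeneousType d μ) (t : ℝ) :
    ∃ K : ℝ≥0∞, K ≠ 0 ∧ K ≠ ∞ ∧
      ∀ j, ∀ Q ∈ D j, ∀ x ∈ Q, μ (qball d x (t * ν ^ j)) ≤ K * μ Q := by
  obtain ⟨K, hK0, hK, h⟩ := hX.exists_dilation (κ * (C + t) / ρ)
  refine ⟨K, hK0, hK, fun j Q hQ x hx => ?_⟩
  have hν : 0 < ν ^ j := zpow_pos hS.ν_pos j
  have hρ := hS.ρ_pos
  obtain ⟨x₁, hx₁, hball⟩ := hS.inner_ball j Q hQ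
  calc μ (qball d x (t * ν ^ j)) ≤ μ (qball d x₁ (κ * (C + t) / ρ * (ρ * ν ^ j))) := by
        refine measure_mono fun y hy => ?_
        have hy : d x y < t * ν ^ j := hy
        have h1 := hS.triangle x₁ y x
        have h2 := hS.dist_le j Q hQ x₁ hx₁ x hx
        have h3 : κ * (C + t) / ρ * (ρ * ν ^ j) = κ * (C * ν ^ j + t * ν ^ j) := by
          field_simp
        have hκ : 0 < κ := by linarith [hS.one_le]
        show d x₁ y < _
        rw [h3]
        refine h1.trans_lt (mul_lt_mul_of_pos_left (by linarith) hκ)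
    _ ≤ K * μ (qball d x₁ (ρ * ν ^ j)) := h x₁ _ (by positivity)
    _ ≤ K * μ Q := by gcongr

theorem HasDyadicScales.measure_pos (hS : HasDyadicScales d D κ ν ρ C)
    (hX : IsHomogeneousType d μ) {j : ℤ} {Q : Set X} (hQ : Q ∈ D j) : 0 < μ Q := by
  obtain ⟨x, -, h⟩ := hS.inner_ball j Q hQ
  exact (hX.measure_qball_pos x (mul_pos hS.ρ_pos (zpow_pos hS.ν_pos j))).trans_le
    (measure_mono h)

theorem HasDyadicScales.measure_lt_top (hS : HasDyadicScales d D κ ν ρ C)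
    (hX : IsHomogeneousType d μ) {j : ℤ} {Q : Set X} (hQ : Q ∈ D j) : μ Q < ∞ := by
  obtain ⟨x, hx, -⟩ := hS.inner_ball j Q hQ
  have h : 0 < 2 * C * ν ^ j :=
    mul_pos (mul_pos two_pos hS.C_pos) (zpow_pos hS.ν_pos j)
  exact (measure_mono (hS.subset_qball hQ hx)).trans_lt (hX.measure_qball_lt_top x h)

theorem IsDyadicFamily.eq_of_mem (hD : IsDyadicFamily d D) {j : ℤ} {P Q : Set X} (hP : P ∈ D j)
    (hQ : Q ∈ D j) {x : X} (hxP : x ∈ P) (hxQ : x ∈ Q) : P = Q :=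
  ((hD.partition j).2 x).unique ⟨hP, hxP⟩ ⟨hQ, hxQ⟩

theorem IsDyadicFamily.disjoint_of_ne (hD : IsDyadicFamily d D) {j : ℤ} {P Q : Set X}
    (hP : P ∈ D j) (hQ : Q ∈ D j) (hne : P ≠ Q) : Disjoint P Q :=
  Set.disjoint_left.2 fun _ hxP hxQ => hne (hD.eq_of_mem hP hQ hxP hxQ)

theorem HasDyadicScales.countable (hS : HasDyadicScales d D κ ν ρ C)
    (hX : IsHomogeneousType d μ) (hD : IsDyadicFamily d D) (j : ℤ) : (D j).Countable := by
  have := hX.sigmaFinite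
  have h := Measure.countable_meas_pos_of_disjoint_iUnion (μ := μ) (As := fun Q : D j => (Q : Set X))
    (fun Q => hD.measurableSet j Q Q.2)
    (fun P Q hne => hD.disjoint_of_ne P.2 Q.2 (fun h => hne (Subtype.ext h)))
  have huniv : {Q : D j | 0 < μ (Q : Set X)} = Set.univ :=
    Set.eq_univ_of_forall fun Q => hS.measure_pos hX Q.2
  rw [huniv, Set.countable_univ_iff] at h
  exact Set.countable_coe_iff.1 h

theorem HasDyadicScales.exists_ballMeasure_le (hS : HasDyadicScales d D κ ν ρ C)
    (hX : IsHomogeneousType d μ) :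
    ∃ K : ℝ≥0∞, K ≠ 0 ∧ K ≠ ∞ ∧
      ∀ j, ∀ Q ∈ D j, ∀ x ∈ Q, ∀ y ∈ Q, ballMeasure μ d x y ≤ K * μ Q := by
  obtain ⟨K, hK0, hK, h⟩ := hS.exists_measure_qball_le hX C
  exact ⟨K, hK0, hK, fun j Q hQ x hx y hy =>
    (measure_mono (qball_mono x (hS.dist_le j Q hQ x hx y hy))).trans (h j Q hQ x hx)⟩

/-! ### A measurable weight comparable to the measure of balls -/

/-- The infimum of `μ(P)` over the pairs `P, Q` of cubes of a common level `j` such that `x ∈ P`,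
`y ∈ Q` and some points of `P` and `Q` are at distance at most `ν ^ j`.  Unlike
`(x, y) ↦ μ(B(x, d(x,y)))`, it is always measurable for the product `σ`-algebra. -/
noncomputable def cubeWeight (μ : Measure X) (d : X → X → ℝ) (D : ℤ → Set (Set X)) (ν : ℝ)
    (x y : X) : ℝ≥0∞ :=
  ⨅ (j : ℤ) (P ∈ D j) (Q ∈ D j), ⨅ (_ : (x, y) ∈ P ×ˢ Q)
    (_ : ∃ x' ∈ P, ∃ y' ∈ Q, d x' y' ≤ ν ^ j), μ P

theorem measurable_cubeWeight (hD : IsDyadicFamily d D) (hc : ∀ j, (D j).Countable) :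
    Measurable fun p : X × X => cubeWeight μ d D ν p.1 p.2 := by
  unfold cubeWeight
  refine Measurable.iInf fun j => Measurable.biInf _ (hc j) fun P hP =>
    Measurable.biInf _ (hc j) fun Q hQ => ?_
  classical
  by_cases h : ∃ x' ∈ P, ∃ y' ∈ Q, d x' y' ≤ ν ^ j
  · simp only [h, iInf_pos, iInf_eq_if]
    exact Measurable.ite ((hD.measurableSet j P hP).prod (hD.measurableSet j Q hQ))
      measurable_const measurable_const
  · simp only [h, iInf_neg, not_false_eq_true, iInf_top]
    exact measurable_const

theorem HasDyadicScales.exists_ballMeasure_le_cubeWeight (hS : HasDyadicScales d D κ ν ρ C)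
    (hX : IsHomogeneousType d μ) :
    ∃ K : ℝ≥0∞, K ≠ 0 ∧ K ≠ ∞ ∧ ∀ x y, ballMeasure μ d x y ≤ K * cubeWeight μ d D ν x y := by
  obtain ⟨K, hK0, hK, h⟩ := hS.exists_measure_qball_le hX (κ * (C + κ * (1 + C)))
  refine ⟨K, hK0, hK, fun x y => ?_⟩
  rw [mul_comm, ← ENNReal.div_le_iff hK0 hK]
  refine le_iInf fun j => le_iInf₂ fun P hP => le_iInf₂ fun Q hQ => le_iInf₂ fun hxy hn => ?_
  rw [ENNReal.div_le_iff hK0 hK, mul_comm]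
  obtain ⟨x', hx', y', hy', hd'⟩ := hn
  refine (measure_mono (qball_mono x ?_)).trans (h j P hP x hxy.1)
  have h1 := hS.dist_le j P hP x hxy.1 x' hx'
  have h2 := hS.dist_le j Q hQ y' hy' y hxy.2
  have hκ : 0 < κ := by linarith [hS.one_le]
  calc d x y ≤ κ * (d x x' + d x' y) := hS.triangle x y x'
    _ ≤ κ * (C * ν ^ j + κ * (ν ^ j + C * ν ^ j)) := by
        gcongr
        exact (hS.triangle x' y y').trans (by gcongr)
    _ = _ := by ring

theorem HasDyadicScales.exists_cubeWeight_le_ballMeasure (hS : HasDyadicScales d D κ ν ρ C)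
    (hX : IsHomogeneousType d μ) (hD : IsDyadicFamily d D) :
    ∃ K : ℝ≥0∞, K ≠ 0 ∧ K ≠ ∞ ∧
      ∀ x y, x ≠ y → cubeWeight μ d D ν x y ≤ K * ballMeasure μ d x y := by
  obtain ⟨K, hK0, hK, h⟩ := hX.exists_dilation (2 * C / ν)
  refine ⟨K, hK0, hK, fun x y hxy => ?_⟩
  have hν := hS.ν_pos
  have hdpos : 0 < d x y := lt_of_le_of_ne (hX.quasiDistance.nonneg x y)
    fun h => hxy ((hX.quasiDistance.eq_zero_iff x y).1 h.symm)
  -- choose the level with `ν ^ (j + 1) ≤ d x y ≤ ν ^ j`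
  obtain ⟨n, hn1, hn2⟩ := exists_mem_Ioc_zpow hdpos (one_lt_inv₀ hν |>.2 hS.ν_lt_one)
  have e1 : (ν⁻¹) ^ n = ν * ν ^ (-n - 1) := by
    rw [inv_zpow, ← zpow_neg, ← zpow_one_add₀ hν.ne']; congr 1; ring
  have e2 : (ν⁻¹) ^ (n + 1) = ν ^ (-n - 1) := by
    rw [inv_zpow, ← zpow_neg]; congr 1; ring
  rw [e1] at hn1
  rw [e2] at hn2
  generalize -n - 1 = j at hn1 hn2
  obtain ⟨P, ⟨hP, hxP⟩, -⟩ := (hD.partition j).2 x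
  obtain ⟨Q, ⟨hQ, hyQ⟩, -⟩ := (hD.partition j).2 y
  calc cubeWeight μ d D ν x y ≤ μ P :=
        iInf_le_of_le j <| iInf₂_le_of_le P hP <| iInf₂_le_of_le Q hQ <|
          iInf₂_le_of_le ⟨hxP, hyQ⟩ ⟨x, hxP, y, hyQ, hn2⟩ le_rfl
    _ ≤ μ (qball d x (2 * C * ν ^ j)) := measure_mono (hS.subset_qball hP hxP)
    _ = μ (qball d x (2 * C / ν * (ν * ν ^ j))) := by congr 2; field_simp
    _ ≤ K * μ (qball d x (ν * ν ^ j)) := h x _ (mul_pos hν (zpow_pos hν j))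
    _ ≤ K * ballMeasure μ d x y := by
        gcongr
        exact measure_mono (qball_mono x hn1.le)

theorem HasDyadicScales.exists_ballMeasure_le_dyadicDist (hS : HasDyadicScales d D κ ν ρ C)
    (hX : IsHomogeneousType d μ) :
    ∃ K : ℝ≥0∞, K ≠ 0 ∧ K ≠ ∞ ∧
      ∀ x y, x ≠ y → ballMeasure μ d x y ≤ K * dyadicDist μ D x y := by
  obtain ⟨K, hK0, hK, h⟩ := hS.exists_ballMeasure_le hX
  refine ⟨K, hK0, hK, fun x y hxy => ?_⟩
  rw [mul_comm, ← ENNReal.div_le_iff hK0 hK, dyadicDist, if_neg hxy]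
  refine le_iInf fun j => le_iInf₂ fun Q hQ => le_iInf₂ fun hx hy => ?_
  rw [ENNReal.div_le_iff hK0 hK, mul_comm]
  exact h j Q hQ x hx y hy

/-! ### Energies with general weights -/

variable {w w' : X → X → ℝ≥0∞} {σ : ℝ}

theorem energy_le_mul_of_weight_le (hσ : 0 < σ) {K : ℝ≥0∞} (hK0 : K ≠ 0) (hK : K ≠ ∞)
    (h : ∀ x y, x ≠ y → w x y ≤ K * w' x y) (u : X → ℝ) :
    energy μ w' σ u ≤ K ^ (1 + 2 * σ) * energy μ w σ u := by
  have hp : 0 < 1 + 2 * σ := by positivity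
  rw [energy, energy, ← lintegral_const_mul' _ _ (ENNReal.rpow_ne_top_of_nonneg hp.le hK)]
  refine lintegral_mono fun p => ?_
  rcases eq_or_ne p.1 p.2 with he | hne
  · simp [he]
  · simp only [div_eq_mul_inv]
    rw [mul_left_comm]
    gcongr
    have h1 := ENNReal.rpow_le_rpow (h _ _ hne) hp.le
    rw [ENNReal.mul_rpow_of_nonneg _ _ hp.le] at h1
    have h2 := ENNReal.inv_le_inv.2 h1
    have hKp0 : K ^ (1 + 2 * σ) ≠ 0 := by simp [ENNReal.rpow_eq_zero_iff, hK0, hK]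
    have hKp : K ^ (1 + 2 * σ) ≠ ∞ := ENNReal.rpow_ne_top_of_nonneg hp.le hK
    rw [ENNReal.mul_inv (Or.inl hKp0) (Or.inl hKp)] at h2
    calc (w' p.1 p.2 ^ (1 + 2 * σ))⁻¹
        = K ^ (1 + 2 * σ) * ((K ^ (1 + 2 * σ))⁻¹ * (w' p.1 p.2 ^ (1 + 2 * σ))⁻¹) := by
          rw [← mul_assoc, ENNReal.mul_inv_cancel hKp0 hKp, one_mul]
      _ ≤ _ := by gcongr

theorem ae_prod_of_ae [SFinite μ] {p : X → Prop} (h : ∀ᵐ x ∂μ, p x) :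
    ∀ᵐ z ∂(μ.prod μ), p z.1 ∧ p z.2 :=
  (Measure.quasiMeasurePreserving_fst.ae h).and (Measure.quasiMeasurePreserving_snd.ae h)

theorem energy_congr_ae [SFinite μ] {u v : X → ℝ} (h : u =ᵐ[μ] v) :
    energy μ w σ u = energy μ w σ v := by
  refine lintegral_congr_ae ?_
  filter_upwards [ae_prod_of_ae h] with p hp
  rw [hp.1, hp.2]

theorem measurable_energy_integrand (hw : Measurable fun p : X × X => w p.1 p.2) {u : X → ℝ}
    (hu : Measurable u) :
    Measurable fun p : X × X => ‖u p.1 - u p.2‖ₑ ^ 2 / w p.1 p.2 ^ (1 + 2 * σ) := by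
  fun_prop

theorem energy_add_le [SFinite μ] (hw : Measurable fun p : X × X => w p.1 p.2)
    (u v : Lp ℝ 2 μ) :
    energy μ w σ (u + v : Lp ℝ 2 μ) ≤ 4 * energy μ w σ u + 4 * energy μ w σ v := by
  rw [energy_congr_ae (Lp.coeFn_add u v), energy, energy, energy,
    ← lintegral_const_mul' _ _ (by simp), ← lintegral_const_mul' _ _ (by simp),
    ← lintegral_add_left
      ((measurable_energy_integrand hw (Lp.stronglyMeasurable u).measurable).const_mul _)]
  refine lintegral_mono fun p => ?_
  simp only [Pi.add_apply, div_eq_mul_inv]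
  rw [← mul_assoc, ← mul_assoc, ← add_mul, ← mul_add]
  gcongr
  have h1 : ‖u p.1 + v p.1 - (u p.2 + v p.2)‖ₑ ≤ ‖u p.1 - u p.2‖ₑ + ‖v p.1 - v p.2‖ₑ := by
    rw [add_sub_add_comm]; exact enorm_add_le _ _
  refine (pow_le_pow_left' h1 2).trans ?_
  generalize ‖u p.1 - u p.2‖ₑ = a
  generalize ‖v p.1 - v p.2‖ₑ = b
  calc (a + b) ^ 2 ≤ (2 * max a b) ^ 2 := by
        rw [two_mul]; gcongr <;> simp
    _ = 4 * (max a b) ^ 2 := by rw [mul_pow]; norm_num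
    _ ≤ 4 * (a ^ 2 + b ^ 2) := by
        gcongr
        rcases max_choice a b with h | h <;> rw [h] <;> simp

theorem energy_smul [SFinite μ] (c : ℝ) (u : Lp ℝ 2 μ) :
    energy μ w σ (c • u : Lp ℝ 2 μ) = ‖c‖ₑ ^ 2 * energy μ w σ u := by
  rw [energy_congr_ae (Lp.coeFn_smul c u), energy, energy, ← lintegral_const_mul' _ _ (by simp)]
  refine lintegral_congr fun p => ?_
  simp only [Pi.smul_apply, smul_eq_mul]
  rw [← mul_sub, enorm_mul, mul_pow, mul_div_assoc]

/-- Lower semicontinuity of an energy with measurable weight with respect to `L²` convergence. -/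
theorem energy_le_of_tendsto [SFinite μ] (hw : Measurable fun p : X × X => w p.1 p.2)
    {g : ℕ → Lp ℝ 2 μ} {v : Lp ℝ 2 μ} (hg : Tendsto g atTop (𝓝 v)) {B : ℝ≥0∞}
    (hB : ∀ᶠ k in atTop, energy μ w σ (g k) ≤ B) : energy μ w σ v ≤ B := by
  obtain ⟨ns, hns, hae⟩ := (tendstoInMeasure_of_tendsto_Lp hg).exists_seq_tendsto_ae
  calc energy μ w σ v
      ≤ ∫⁻ p : X × X, liminf (fun k => ‖g (ns k) p.1 - g (ns k) p.2‖ₑ ^ 2 /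
          w p.1 p.2 ^ (1 + 2 * σ)) atTop ∂(μ.prod μ) := by
        refine lintegral_mono_ae ?_
        filter_upwards [ae_prod_of_ae hae] with p hp
        -- at a zero of the numerator the quotient need not be continuous, but it vanishes there
        rcases eq_or_ne (‖v p.1 - v p.2‖ₑ ^ 2) 0 with h0 | h0
        · rw [h0, ENNReal.zero_div]; exact zero_le
        · refine (Tendsto.liminf_eq ?_).ge
          exact ENNReal.Tendsto.div_const
            (((ENNReal.continuous_pow 2).tendsto _).comp (hp.1.sub hp.2).enorm) (Or.inl h0)
    _ ≤ liminf (fun k => energy μ w σ (g (ns k))) atTop :=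
        lintegral_liminf_le fun k =>
          measurable_energy_integrand hw (Lp.stronglyMeasurable _).measurable
    _ ≤ B := liminf_le_of_le (by isBoundedDefault) fun b hb => by
        obtain ⟨k, h1, h2⟩ := (hb.and (hns.tendsto_atTop.eventually hB)).exists
        exact h1.trans h2

end Measure

/-! ### Cancellation on small cubes -/

theorem inner_eq_of_mem_span_insert {E : Type*} [NormedAddCommGroup E] [InnerProductSpace ℝ E]
    {e u : E} {s : Set E} (he : e ∉ s)
    (ho : Orthonormal ℝ (Subtype.val : ↥(insert e s) → E))
    (hu : ∀ h ∈ s, inner ℝ h u = 0) {f : E} (hf : f ∈ Submodule.span ℝ (insert e s)) :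
    inner ℝ f u = inner ℝ f e * inner ℝ e u := by
  have hee : inner ℝ e e = (1 : ℝ) := by
    have := ho.1 ⟨e, Set.mem_insert e s⟩
    rw [real_inner_self_eq_norm_sq, this, one_pow]
  induction hf using Submodule.span_induction with
  | mem x hx =>
    rcases hx with rfl | hx
    · rw [hee, one_mul]
    · have hxe : inner ℝ x e = (0 : ℝ) :=
        ho.2 (i := ⟨x, Set.mem_insert_of_mem e hx⟩) (j := ⟨e, Set.mem_insert e s⟩)
          (fun h => he (by rwa [← show x = e from congrArg Subtype.val h]))
      rw [hu x hx, hxe, zero_mul]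
  | zero => simp
  | add x y _ _ hx hy => rw [inner_add_left, inner_add_left, hx, hy, add_mul]
  | smul a x _ hx => rw [real_inner_smul_left, real_inner_smul_left, hx, mul_assoc]

variable [MeasurableSpace X] {d : X → X → ℝ} {μ : Measure X} {D : ℤ → Set (Set X)}
  {κ ν ρ C : ℝ} {H : ℤ → Set X → Set (Lp ℝ 2 μ)} {l : ℝ}

theorem haarProj_eq_zero_iff {u : Lp ℝ 2 μ} :
    haarProj D H l u = 0 ↔ u ∈ (haarSpan D H l)ᗮ := by
  have : CompleteSpace (haarSpan D H l) :=
    (Submodule.isClosed_topologicalClosure _).completeSpace_coe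
  exact Submodule.starProjection_apply_eq_zero_iff _

theorem inner_eq_zero_of_haarProj_eq_zero {u : Lp ℝ 2 μ} (hu : haarProj D H l u = 0) {j : ℤ}
    {Q : Set X} (hQ : Q ∈ D j) (hl : ENNReal.ofReal l < μ Q) : ∀ h ∈ H j Q, inner ℝ h u = 0 :=
  fun _ hh => haarProj_eq_zero_iff.1 hu _
    (Submodule.le_topologicalClosure _ (Submodule.subset_span ⟨j, Q, hQ, hl, hh⟩))

/-- A function orthogonal to the Haar functions of a cube has the same average on the cube and on
each of its offspring. -/
theorem mul_setIntegral_offspring (hD : IsDyadicFamily d D) (hH : IsHaarSystem μ D H)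
    {u : Lp ℝ 2 μ} {j : ℤ} {Q Q' : Set X} (hQ : Q ∈ D j) (hQ' : Q' ∈ D (j + 1)) (hsub : Q' ⊆ Q)
    (h0 : 0 < μ Q) (htop : μ Q < ∞) (hu : ∀ h ∈ H j Q, inner ℝ h u = 0) :
    μ.real Q * ∫ x in Q', u x ∂μ = μ.real Q' * ∫ x in Q, u x ∂μ := by
  obtain ⟨e, he, heH, ho, hspan⟩ := hH j Q hQ
  have hmQ := hD.measurableSet j Q hQ
  have hmQ' := hD.measurableSet _ Q' hQ'
  have htop' : μ Q' ≠ ∞ := (measure_mono hsub |>.trans_lt htop).ne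
  have he' : e = indicatorConstLp 2 hmQ htop.ne (Real.sqrt (μ.real Q))⁻¹ :=
    Lp.ext (he.trans indicatorConstLp_coeFn.symm)
  have hf : indicatorConstLp 2 hmQ' htop' (1 : ℝ) ∈ cubeFunctions μ D j Q := by
    have hcoe := indicatorConstLp_coeFn (p := 2) (hs := hmQ') (hμs := htop') (c := (1 : ℝ))
    refine ⟨?_, fun Q'' hQ'' => ?_⟩
    · filter_upwards [hcoe] with x hx hxQ
      rw [hx, Set.indicator_of_notMem fun h => hxQ (hsub h)]
    · rcases eq_or_ne Q'' Q' with rfl | hne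
      · refine ⟨1, ?_⟩
        filter_upwards [hcoe] with x hx hxQ
        rw [hx, Set.indicator_of_mem hxQ]
      · refine ⟨0, ?_⟩
        filter_upwards [hcoe] with x hx hxQ
        rw [hx, Set.indicator_of_notMem fun h => hne (hD.eq_of_mem hQ''.1 hQ' hxQ h)]
  rw [← hspan] at hf
  have key := inner_eq_of_mem_span_insert heH ho hu hf
  have hsq : (Real.sqrt (μ.real Q))⁻¹ * (Real.sqrt (μ.real Q))⁻¹ = (μ.real Q)⁻¹ := by
    rw [← mul_inv, Real.mul_self_sqrt measureReal_nonneg]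
  have hpos : μ.real Q ≠ 0 := (ENNReal.toReal_pos h0.ne' htop.ne).ne'
  rw [he', L2.inner_indicatorConstLp_one, L2.inner_indicatorConstLp_one,
    setIntegral_indicatorConstLp hmQ', L2.inner_indicatorConstLp_eq_inner_setIntegral,
    Set.inter_eq_self_of_subset_right hsub] at key
  simp only [smul_eq_mul, RCLike.inner_apply, conj_trivial] at key
  rw [key]
  calc _ = μ.real Q * ((Real.sqrt (μ.real Q))⁻¹ * (Real.sqrt (μ.real Q))⁻¹) * μ.real Q' *
        ∫ x in Q, u x ∂μ := by ring
    _ = _ := by rw [hsq, mul_inv_cancel₀ hpos, one_mul]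

/-- The cube of level `j` that contains `x`. -/
def cubeAt (D : ℤ → Set (Set X)) (j : ℤ) (x : X) : Set X := ⋃₀ {Q ∈ D j | x ∈ Q}

theorem IsDyadicFamily.cubeAt_eq (hD : IsDyadicFamily d D) {j : ℤ} {Q : Set X} (hQ : Q ∈ D j)
    {x : X} (hx : x ∈ Q) : cubeAt D j x = Q := by
  have : {Q ∈ D j | x ∈ Q} = {Q} :=
    Set.eq_singleton_iff_unique_mem.2 ⟨⟨hQ, hx⟩, fun P hP => hD.eq_of_mem hP.1 hQ hP.2 hx⟩
  rw [cubeAt, this, Set.sUnion_singleton]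

theorem IsDyadicFamily.cubeAt_mem (hD : IsDyadicFamily d D) (j : ℤ) (x : X) :
    cubeAt D j x ∈ D j := by
  obtain ⟨Q, ⟨hQ, hx⟩, -⟩ := (hD.partition j).2 x
  rwa [hD.cubeAt_eq hQ hx]

theorem IsDyadicFamily.mem_cubeAt (hD : IsDyadicFamily d D) (j : ℤ) (x : X) :
    x ∈ cubeAt D j x := by
  obtain ⟨Q, ⟨hQ, hx⟩, -⟩ := (hD.partition j).2 x
  rwa [hD.cubeAt_eq hQ hx]

theorem IsDyadicFamily.antitone_cubeAt (hD : IsDyadicFamily d D) (x : X) :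
    Antitone fun j => cubeAt D j x := by
  refine antitone_int_of_succ_le fun j => ?_
  obtain ⟨P, ⟨hP, hsub⟩, -⟩ := hD.parent j _ (hD.cubeAt_mem (j + 1) x)
  rw [hD.cubeAt_eq hP (hsub (hD.mem_cubeAt _ x))]
  exact hsub

theorem IsDyadicFamily.tendsto_measure_cubeAt_atBot (hD : IsDyadicFamily d D)
    (hinf : μ Set.univ = ∞) (x : X) : Tendsto (fun j => μ (cubeAt D j x)) atBot (𝓝 ∞) := by
  have h := tendsto_measure_iUnion_atBot (μ := μ) (hD.antitone_cubeAt x)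
  have hU : ⋃ j, cubeAt D j x = Set.univ := by
    refine Set.eq_univ_of_univ_subset ?_
    rw [← hD.quadrant 0 _ (hD.cubeAt_mem 0 x)]
    refine Set.iUnion_subset fun i => Set.iUnion₂_subset fun P hP => Set.iUnion_subset fun hs => ?_
    rw [← hD.cubeAt_eq hP (hs (hD.mem_cubeAt 0 x))]
    exact Set.subset_iUnion (fun j => cubeAt D j x) i
  rwa [hU, hinf] at h

theorem HasDyadicScales.tendsto_measure_cubeAt_atTop (hS : HasDyadicScales d D κ ν ρ C)
    (hX : IsHomogeneousType d μ) (hD : IsDyadicFamily d D) (hatom : ∀ x : X, μ {x} = 0) (x : X) :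
    Tendsto (fun j => μ (cubeAt D j x)) atTop (𝓝 0) := by
  have h := tendsto_measure_iInter_atTop (μ := μ)
    (fun j => (hD.measurableSet j _ (hD.cubeAt_mem j x)).nullMeasurableSet)
    (hD.antitone_cubeAt x) ⟨0, (hS.measure_lt_top hX (hD.cubeAt_mem 0 x)).ne⟩
  have hI : μ (⋂ j, cubeAt D j x) = 0 := by
    refine measure_mono_null (fun y hy => ?_) (hatom x)
    have hν : Tendsto (fun n : ℕ => C * ν ^ n) atTop (𝓝 (C * 0)) :=
      (tendsto_pow_atTop_nhds_zero_of_lt_one hS.ν_pos.le hS.ν_lt_one).const_mul C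
    have hle : d x y ≤ C * 0 := ge_of_tendsto' hν fun n => by
      have := hS.dist_le n _ (hD.cubeAt_mem n x) x (hD.mem_cubeAt n x) y (Set.mem_iInter.1 hy n)
      simpa using this
    rw [mul_zero] at hle
    exact ((hX.quasiDistance.eq_zero_iff x y).1
      (le_antisymm hle (hX.quasiDistance.nonneg x y))).symm
  rwa [hI] at h

theorem sq_setIntegral_le {Q : Set X} (hQ : MeasurableSet Q) (htop : μ Q ≠ ∞) (u : Lp ℝ 2 μ) :
    (∫ x in Q, u x ∂μ) ^ 2 ≤ μ.real Q * ‖u‖ ^ 2 := by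
  have h := abs_real_inner_le_norm (indicatorConstLp 2 hQ htop (1 : ℝ)) u
  rw [L2.inner_indicatorConstLp_one, norm_indicatorConstLp (by norm_num) (by norm_num)] at h
  calc (∫ x in Q, u x ∂μ) ^ 2 = |∫ x in Q, u x ∂μ| ^ 2 := (sq_abs _).symm
    _ ≤ _ := pow_le_pow_left₀ (abs_nonneg _) h 2
    _ = μ.real Q * ‖u‖ ^ 2 := by
      rw [mul_pow, mul_pow, norm_one, one_pow, one_mul, ← Real.rpow_natCast, ← Real.rpow_mul
        measureReal_nonneg]
      norm_num

/-- The averages of `u ∈ Ker Π_l` over the ancestors of a cube of measure greater than `l` all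
coincide with the average over any offspring of this cube; as the ancestors have unbounded measure
and `u` is square integrable, this average is zero. -/
theorem setIntegral_cubeAt_succ_eq_zero (hS : HasDyadicScales d D κ ν ρ C)
    (hX : IsHomogeneousType d μ) (hD : IsDyadicFamily d D) (hH : IsHaarSystem μ D H)
    (hinf : μ Set.univ = ∞) {u : Lp ℝ 2 μ} (hu : haarProj D H l u = 0) {x : X} {j : ℤ}
    (hl : ENNReal.ofReal l < μ (cubeAt D j x)) : ∫ y in cubeAt D (j + 1) x, u y ∂μ = 0 := by
  have hpos : ∀ i, 0 < μ.real (cubeAt D i x) := fun i =>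
    ENNReal.toReal_pos (hS.measure_pos hX (hD.cubeAt_mem i x)).ne'
      (hS.measure_lt_top hX (hD.cubeAt_mem i x)).ne
  set a : ℤ → ℝ := fun i => (∫ y in cubeAt D i x, u y ∂μ) / μ.real (cubeAt D i x) with ha
  have hstep : ∀ i ≤ j, a (i + 1) = a i := by
    intro i hi
    have hQ := hD.cubeAt_mem i x
    have hsub : cubeAt D (i + 1) x ⊆ cubeAt D i x := hD.antitone_cubeAt x (by lia)
    have := mul_setIntegral_offspring hD hH hQ (hD.cubeAt_mem (i + 1) x) hsub
      (hS.measure_pos hX hQ) (hS.measure_lt_top hX hQ)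
      (inner_eq_zero_of_haarProj_eq_zero hu hQ
        (hl.trans_le (measure_mono (hD.antitone_cubeAt x hi))))
    rw [ha]
    simp only
    rw [div_eq_div_iff (hpos _).ne' (hpos _).ne']
    linarith
  have hconst : ∀ i ≤ j + 1, a i = a (j + 1) := fun i hi => by
    induction i, hi using Int.leInductionDown with
    | base => rfl
    | pred i hi ih => rw [← ih, ← hstep (i - 1) (by lia), sub_add_cancel]
  have hbound : ∀ i ≤ j + 1, a (j + 1) ^ 2 * μ.real (cubeAt D i x) ≤ ‖u‖ ^ 2 := by
    intro i hi
    have hQ := hD.cubeAt_mem i x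
    have := sq_setIntegral_le (hD.measurableSet i _ hQ) (hS.measure_lt_top hX hQ).ne u
    have hint : ∫ y in cubeAt D i x, u y ∂μ = a (j + 1) * μ.real (cubeAt D i x) := by
      rw [← hconst i hi, ha]
      exact (div_mul_cancel₀ _ (hpos i).ne').symm
    rw [hint] at this
    refine le_of_mul_le_mul_left ?_ (hpos i)
    linarith
  have ha0 : a (j + 1) = 0 := by
    by_contra hne
    have hsq : 0 < a (j + 1) ^ 2 := by positivity
    have hev := (hD.tendsto_measure_cubeAt_atBot hinf x).eventually
      (lt_mem_nhds (ENNReal.ofReal_lt_top (r := ‖u‖ ^ 2 / a (j + 1) ^ 2)))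
    obtain ⟨i, h1, h2⟩ := (hev.and (eventually_le_atBot (j + 1))).exists
    rw [ENNReal.ofReal_lt_iff_lt_toReal (by positivity)
      (hS.measure_lt_top hX (hD.cubeAt_mem i x)).ne, div_lt_iff₀ hsq] at h1
    have := hbound i h2
    rw [Measure.real] at this
    linarith
  rw [ha] at ha0
  exact (div_eq_zero_iff.1 ha0).resolve_right (hpos _).ne'

/-! ### The energy on small cubes -/

theorem measure_mul_enorm_sq_le {Q : Set X} (htop : μ Q ≠ ∞) (u : Lp ℝ 2 μ)
    (h0 : ∫ x in Q, u x ∂μ = 0) (a : ℝ) :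
    ‖a‖ₑ ^ 2 * μ Q ≤ ∫⁻ y in Q, ‖a - u y‖ₑ ^ 2 ∂μ := by
  have : IsFiniteMeasure (μ.restrict Q) := isFiniteMeasure_restrict.2 htop
  have hu : MemLp u 2 (μ.restrict Q) := (Lp.memLp u).restrict Q
  have hui : Integrable u (μ.restrict Q) := hu.integrable (by norm_num)
  have hint : ∫ y in Q, (a - u y) ^ 2 ∂μ = a ^ 2 * μ.real Q + ∫ y in Q, u y ^ 2 ∂μ := by
    have : ∀ y, (a - u y) ^ 2 = (a ^ 2 - 2 * a * u y) + u y ^ 2 := fun y => by ring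
    simp only [this]
    rw [integral_add (f := fun y => a ^ 2 - 2 * a * u y)
        ((integrable_const _).sub (hui.const_mul _)) hu.integrable_sq,
      integral_sub (integrable_const _) (hui.const_mul _), integral_const_mul, h0]
    simp [mul_comm]
  have hsq : ∀ b : ℝ, ‖b‖ₑ ^ 2 = ENNReal.ofReal (b ^ 2) := fun b => by
    rw [← sq_abs, ENNReal.ofReal_pow (abs_nonneg b), Real.enorm_eq_ofReal_abs]
  simp only [hsq]
  rw [← ofReal_integral_eq_lintegral_ofReal (f := fun y => (a - u y) ^ 2)
    ((memLp_const a).sub hu).integrable_sq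
    (Eventually.of_forall fun _ => sq_nonneg _), hint, ← ENNReal.ofReal_toReal htop,
    ← ENNReal.ofReal_mul (sq_nonneg a)]
  exact ENNReal.ofReal_le_ofReal (le_add_of_nonneg_right (integral_nonneg fun _ => sq_nonneg _))

/-- Poincaré inequality on a cube: for a function of mean zero on `Q`, the part of the energy
carried by `Q × Q` controls the `L²` norm on `Q`. -/
theorem setLIntegral_sq_le_energy_on [SFinite μ] {w : X → X → ℝ≥0∞} {σ : ℝ} (hσ : 0 < σ)
    {K : ℝ≥0∞} (hK0 : K ≠ 0) (hK : K ≠ ∞) {Q : Set X} (hQ : MeasurableSet Q)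
    (hQ0 : μ Q ≠ 0) (hQl : μ Q ≤ ENNReal.ofReal l) (hw : ∀ x ∈ Q, ∀ y ∈ Q, w x y ≤ K * μ Q)
    (u : Lp ℝ 2 μ) (h0 : ∫ x in Q, u x ∂μ = 0) :
    (K ^ (1 + 2 * σ) * ENNReal.ofReal l ^ (2 * σ))⁻¹ * ∫⁻ x in Q, ‖u x‖ₑ ^ 2 ∂μ ≤
      ∫⁻ p in Q ×ˢ Q, ‖u p.1 - u p.2‖ₑ ^ 2 / w p.1 p.2 ^ (1 + 2 * σ) ∂(μ.prod μ) := by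
  have hp : 0 < 1 + 2 * σ := by positivity
  have htop : μ Q ≠ ∞ := ne_top_of_le_ne_top ENNReal.ofReal_ne_top hQl
  have hmeas : Measurable u := (Lp.stronglyMeasurable u).measurable
  have hKp0 : K ^ (1 + 2 * σ) ≠ 0 := by simp [ENNReal.rpow_eq_zero_iff, hK0, hK]
  have hKp : K ^ (1 + 2 * σ) ≠ ∞ := ENNReal.rpow_ne_top_of_nonneg hp.le hK
  have hconst : (K ^ (1 + 2 * σ) * ENNReal.ofReal l ^ (2 * σ))⁻¹ ≤
      ((K * μ Q) ^ (1 + 2 * σ))⁻¹ * μ Q := by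
    rw [ENNReal.mul_rpow_of_nonneg _ _ hp.le, ENNReal.rpow_add _ _ hQ0 htop, ENNReal.rpow_one,
      ENNReal.mul_inv (Or.inl hKp0) (Or.inl hKp), ENNReal.mul_inv (Or.inl hKp0) (Or.inl hKp),
      ENNReal.mul_inv (Or.inl hQ0) (Or.inl htop), mul_assoc, mul_right_comm,
      ENNReal.inv_mul_cancel hQ0 htop, one_mul]
    gcongr
  calc _ ≤ ((K * μ Q) ^ (1 + 2 * σ))⁻¹ * μ Q * ∫⁻ x in Q, ‖u x‖ₑ ^ 2 ∂μ := by gcongr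
    _ = ((K * μ Q) ^ (1 + 2 * σ))⁻¹ * ∫⁻ x in Q, ‖u x‖ₑ ^ 2 * μ Q ∂μ := by
        rw [lintegral_mul_const _ (by fun_prop), mul_assoc, mul_comm (μ Q)]
    _ ≤ ((K * μ Q) ^ (1 + 2 * σ))⁻¹ * ∫⁻ x in Q, ∫⁻ y in Q, ‖u x - u y‖ₑ ^ 2 ∂μ ∂μ := by
        gcongr with x
        exact measure_mul_enorm_sq_le htop u h0 (u x)
    _ = ∫⁻ p in Q ×ˢ Q, ((K * μ Q) ^ (1 + 2 * σ))⁻¹ * ‖u p.1 - u p.2‖ₑ ^ 2 ∂(μ.prod μ) := by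
        rw [lintegral_const_mul _ (by fun_prop), ← Measure.prod_restrict, lintegral_prod]
        exact Measurable.aemeasurable (by fun_prop)
    _ ≤ _ := by
        refine setLIntegral_mono' (hQ.prod hQ) fun p hpQ => ?_
        rw [mul_comm, div_eq_mul_inv]
        gcongr
        exact hw _ hpQ.1 _ hpQ.2

/-- The cubes of measure at most `l` whose parent has measure greater than `l`. -/
def stoppingCubes (μ : Measure X) (D : ℤ → Set (Set X)) (l : ℝ) : Set (Set X) :=
  {Q | ∃ j, Q ∈ D (j + 1) ∧ μ Q ≤ ENNReal.ofReal l ∧ ∃ P ∈ D j, Q ⊆ P ∧ ENNReal.ofReal l < μ P}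

theorem IsDyadicFamily.pairwiseDisjoint_stoppingCubes (hD : IsDyadicFamily d D) :
    (stoppingCubes μ D l).PairwiseDisjoint id := by
  rintro Q ⟨j, hQ, hl, P, hP, hPQ, hlP⟩ Q' ⟨j', hQ', hl', P', hP', hPQ', hlP'⟩ hne
  refine Set.disjoint_left.2 fun x hx hx' => hne ?_
  simp only [id] at hx hx'
  rw [← hD.cubeAt_eq hQ hx] at hl ⊢
  rw [← hD.cubeAt_eq hQ' hx'] at hl' ⊢
  rw [← hD.cubeAt_eq hP (hPQ hx)] at hlP
  rw [← hD.cubeAt_eq hP' (hPQ' hx')] at hlP'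
  rcases lt_trichotomy j j' with h | h | h
  · exact absurd (hlP'.trans_le ((measure_mono (hD.antitone_cubeAt x
      (by lia : j + 1 ≤ j'))).trans hl)) (lt_irrefl _)
  · rw [h]
  · exact absurd (hlP.trans_le ((measure_mono (hD.antitone_cubeAt x
      (by lia : j' + 1 ≤ j))).trans hl')) (lt_irrefl _)

theorem HasDyadicScales.sUnion_stoppingCubes (hS : HasDyadicScales d D κ ν ρ C)
    (hX : IsHomogeneousType d μ) (hD : IsDyadicFamily d D) (hatom : ∀ x : X, μ {x} = 0)
    (hinf : μ Set.univ = ∞) (hl : 0 < l) : ⋃₀ stoppingCubes μ D l = Set.univ := by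
  refine Set.eq_univ_of_forall fun x => ?_
  have hl0 : 0 < ENNReal.ofReal l := ENNReal.ofReal_pos.2 hl
  obtain ⟨b, hb⟩ := ((hS.tendsto_measure_cubeAt_atTop hX hD hatom x).eventually
    (gt_mem_nhds hl0)).exists
  obtain ⟨a, ha⟩ := ((hD.tendsto_measure_cubeAt_atBot hinf x).eventually
    (lt_mem_nhds (ENNReal.ofReal_lt_top (r := l)))).exists
  obtain ⟨j, hj, hmax⟩ := Int.exists_greatest_of_bdd
    (P := fun j => ENNReal.ofReal l < μ (cubeAt D j x))
    ⟨b, fun z hz => by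
      by_contra! hbz
      exact absurd (hz.trans_le ((measure_mono (hD.antitone_cubeAt x hbz.le)).trans hb.le))
        (lt_irrefl _)⟩ ⟨a, ha⟩
  have hsucc : μ (cubeAt D (j + 1) x) ≤ ENNReal.ofReal l := by
    by_contra! h
    have := hmax _ h
    lia
  exact ⟨cubeAt D (j + 1) x, ⟨j, hD.cubeAt_mem _ x, hsucc, cubeAt D j x, hD.cubeAt_mem _ x,
    hD.antitone_cubeAt x (by lia), hj⟩, hD.mem_cubeAt _ x⟩

theorem lintegral_enorm_sq_eq (u : Lp ℝ 2 μ) :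
    ∫⁻ x, ‖u x‖ₑ ^ 2 ∂μ = ENNReal.ofReal (‖u‖ ^ 2) := by
  have h := eLpNorm_nnreal_pow_eq_lintegral (μ := μ) (f := u) (p := 2) two_ne_zero
  rw [ENNReal.ofReal_pow (norm_nonneg _), ofReal_norm, Lp.enorm_def]
  simpa using h.symm

theorem HasDyadicScales.exists_energyQ_ge (hS : HasDyadicScales d D κ ν ρ C)
    (hX : IsHomogeneousType d μ) (hD : IsDyadicFamily d D) (hH : IsHaarSystem μ D H)
    (hatom : ∀ x : X, μ {x} = 0) (hinf : μ Set.univ = ∞) {σ : ℝ} (hσ : 0 < σ) (hl : 0 < l) :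
    ∃ c : ℝ, 0 < c ∧ ∀ u : Lp ℝ 2 μ, haarProj D H l u = 0 →
      ENNReal.ofReal (c * ‖u‖ ^ 2) ≤ energyQ μ d σ u := by
  have := hX.sigmaFinite
  obtain ⟨K, hK0, hK, hw⟩ := hS.exists_ballMeasure_le hX
  set c : ℝ≥0∞ := (K ^ (1 + 2 * σ) * ENNReal.ofReal l ^ (2 * σ))⁻¹ with hc
  have hc0 : c ≠ 0 := ENNReal.inv_ne_zero.2 (ENNReal.mul_ne_top
    (ENNReal.rpow_ne_top_of_nonneg (by positivity) hK)
    (ENNReal.rpow_ne_top_of_nonneg (by positivity) ENNReal.ofReal_ne_top))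
  have hctop : c ≠ ∞ := by
    refine ENNReal.inv_ne_top.2 (mul_ne_zero ?_ ?_)
    · simp [ENNReal.rpow_eq_zero_iff, hK0, hK]
    · simp [ENNReal.rpow_eq_zero_iff, hl]
  refine ⟨c.toReal, ENNReal.toReal_pos hc0 hctop, fun u hu => ?_⟩
  have hcount : (stoppingCubes μ D l).Countable :=
    (Set.countable_iUnion fun j => hS.countable hX hD (j + 1)).mono
      fun Q ⟨j, hQ, _⟩ => Set.mem_iUnion.2 ⟨j, hQ⟩
  have hmeas : ∀ Q ∈ stoppingCubes μ D l, MeasurableSet Q :=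
    fun Q ⟨j, hQ, _⟩ => hD.measurableSet _ Q hQ
  have hdisj := hD.pairwiseDisjoint_stoppingCubes (μ := μ) (l := l)
  have hdisj2 : (stoppingCubes μ D l).PairwiseDisjoint fun Q => Q ×ˢ Q :=
    fun P hP Q hQ hne => Set.disjoint_prod.2 (Or.inl (hdisj hP hQ hne))
  rw [ENNReal.ofReal_mul ENNReal.toReal_nonneg, ENNReal.ofReal_toReal hctop,
    ← lintegral_enorm_sq_eq, ← setLIntegral_univ,
    ← hS.sUnion_stoppingCubes hX hD hatom hinf hl, Set.sUnion_eq_biUnion,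
    lintegral_biUnion hcount hmeas hdisj, ← ENNReal.tsum_mul_left]
  calc _ ≤ ∑' Q : stoppingCubes μ D l, ∫⁻ p in (Q : Set X) ×ˢ (Q : Set X),
          ‖u p.1 - u p.2‖ₑ ^ 2 / ballMeasure μ d p.1 p.2 ^ (1 + 2 * σ) ∂(μ.prod μ) := by
        refine ENNReal.tsum_le_tsum fun ⟨Q, hQs⟩ => ?_
        obtain ⟨j, hQ, hQl, P, hP, hQP, hPl⟩ := hQs
        refine setLIntegral_sq_le_energy_on hσ hK0 hK (hmeas Q ⟨j, hQ, hQl, P, hP, hQP, hPl⟩)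
          (hS.measure_pos hX hQ).ne' hQl (hw _ Q hQ) u ?_
        obtain ⟨x, hx, -⟩ := hS.inner_ball _ Q hQ
        rw [← hD.cubeAt_eq hQ hx]
        refine setIntegral_cubeAt_succ_eq_zero hS hX hD hH hinf hu ?_
        rwa [hD.cubeAt_eq hP (hQP hx)]
    _ = ∫⁻ p in ⋃ Q ∈ stoppingCubes μ D l, Q ×ˢ Q,
          ‖u p.1 - u p.2‖ₑ ^ 2 / ballMeasure μ d p.1 p.2 ^ (1 + 2 * σ) ∂(μ.prod μ) :=
        (lintegral_biUnion hcount (fun Q hQ => (hmeas Q hQ).prod (hmeas Q hQ)) hdisj2 _).symm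
    _ ≤ energyQ μ d σ u := setLIntegral_le_lintegral _ _

/-! ### Linearity and completeness -/

/-- The energy `energyQ` is comparable to an energy with measurable weight. -/
theorem HasDyadicScales.exists_energyQ_comparable (hS : HasDyadicScales d D κ ν ρ C)
    (hX : IsHomogeneousType d μ) (hD : IsDyadicFamily d D) {σ : ℝ} (hσ : 0 < σ) :
    ∃ L : ℝ≥0∞, L ≠ 0 ∧ L ≠ ∞ ∧ ∀ u : X → ℝ,
      energyQ μ d σ u ≤ L * energy μ (cubeWeight μ d D ν) σ u ∧
      energy μ (cubeWeight μ d D ν) σ u ≤ L * energyQ μ d σ u := by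
  obtain ⟨K₁, h10, h1, hw1⟩ := hS.exists_ballMeasure_le_cubeWeight hX
  obtain ⟨K₂, h20, h2, hw2⟩ := hS.exists_cubeWeight_le_ballMeasure hX hD
  refine ⟨K₁ ^ (1 + 2 * σ) + K₂ ^ (1 + 2 * σ), ?_, ?_, fun u => ⟨?_, ?_⟩⟩
  · simp [ENNReal.rpow_eq_zero_iff, h10, h1]
  · exact ENNReal.add_ne_top.2 ⟨ENNReal.rpow_ne_top_of_nonneg (by positivity) h1,
      ENNReal.rpow_ne_top_of_nonneg (by positivity) h2⟩
  · exact (energy_le_mul_of_weight_le hσ h20 h2 hw2 u).trans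
      (mul_le_mul_left le_add_self _)
  · exact (energy_le_mul_of_weight_le hσ h10 h1 (fun x y _ => hw1 x y) u).trans
      (mul_le_mul_left le_self_add _)

theorem HasDyadicScales.sobolevQ_subset_sobolevDyadic (hS : HasDyadicScales d D κ ν ρ C)
    (hX : IsHomogeneousType d μ) {σ : ℝ} (hσ : 0 < σ) :
    sobolevQ μ d σ ⊆ sobolevDyadic μ D σ := by
  obtain ⟨K, hK0, hK, hw⟩ := hS.exists_ballMeasure_le_dyadicDist hX
  exact fun u hu => (energy_le_mul_of_weight_le hσ hK0 hK hw u).trans_lt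
    (ENNReal.mul_lt_top (ENNReal.rpow_lt_top_of_nonneg (by positivity) hK) hu)

theorem HasDyadicScales.mem_sobolevQ_iff (hS : HasDyadicScales d D κ ν ρ C)
    (hX : IsHomogeneousType d μ) (hD : IsDyadicFamily d D) {σ : ℝ} (hσ : 0 < σ)
    {u : Lp ℝ 2 μ} : u ∈ sobolevQ μ d σ ↔ energy μ (cubeWeight μ d D ν) σ u < ∞ := by
  obtain ⟨L, -, hL, h⟩ := hS.exists_energyQ_comparable hX hD hσ
  exact ⟨fun hu => (h u).2.trans_lt (ENNReal.mul_lt_top hL.lt_top hu),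
    fun hu => (h u).1.trans_lt (ENNReal.mul_lt_top hL.lt_top hu)⟩

theorem HasDyadicScales.exists_submodule_sobolevQ (hS : HasDyadicScales d D κ ν ρ C)
    (hX : IsHomogeneousType d μ) (hD : IsDyadicFamily d D) {σ : ℝ} (hσ : 0 < σ) :
    ∃ S : Submodule ℝ (Lp ℝ 2 μ), (S : Set (Lp ℝ 2 μ)) = sobolevQ μ d σ := by
  have := hX.sigmaFinite
  have hw := measurable_cubeWeight (ν := ν) (μ := μ) hD (hS.countable hX hD)
  refine ⟨{ carrier := sobolevQ μ d σ, add_mem' := ?_, zero_mem' := ?_, smul_mem' := ?_ }, rfl⟩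
  · intro u v hu hv
    rw [hS.mem_sobolevQ_iff hX hD hσ] at hu hv ⊢
    exact (energy_add_le hw u v).trans_lt (ENNReal.add_lt_top.2
      ⟨ENNReal.mul_lt_top (by simp) hu, ENNReal.mul_lt_top (by simp) hv⟩)
  · have h0 : energyQ μ d σ (0 : Lp ℝ 2 μ) = 0 := by
      rw [← zero_smul ℝ (0 : Lp ℝ 2 μ), energyQ, energy_smul]
      simp
    show energyQ μ d σ (0 : Lp ℝ 2 μ) < ∞
    rw [h0]
    exact ENNReal.zero_lt_top
  · intro c u hu
    show energyQ μ d σ (c • u : Lp ℝ 2 μ) < ∞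
    rw [energyQ, energy_smul]
    exact ENNReal.mul_lt_top (by simp) hu

/-- `H^σ_{d,μ}` is complete: a sequence that is Cauchy for its norm converges for this norm to its
`L²` limit. -/
theorem HasDyadicScales.exists_tendsto_sobolevNorm (hS : HasDyadicScales d D κ ν ρ C)
    (hX : IsHomogeneousType d μ) (hD : IsDyadicFamily d D) {σ : ℝ} (hσ : 0 < σ)
    {f : ℕ → Lp ℝ 2 μ} (hf : ∀ n, f n ∈ sobolevQ μ d σ)
    (hC : ∀ ε : ℝ≥0∞, 0 < ε → ∃ N, ∀ m ≥ N, ∀ n ≥ N, sobolevNorm d σ (f m - f n) < ε) :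
    ∃ u ∈ sobolevQ μ d σ, Tendsto f atTop (𝓝 u) ∧
      Tendsto (fun n => sobolevNorm d σ (f n - u)) atTop (𝓝 0) := by
  have := hX.sigmaFinite
  have hw := measurable_cubeWeight (ν := ν) (μ := μ) hD (hS.countable hX hD)
  obtain ⟨L, hL0, hL, hcomp⟩ := hS.exists_energyQ_comparable hX hD hσ
  have hcauchy : CauchySeq f := EMetric.cauchySeq_iff.2 fun ε hε => by
    obtain ⟨N, hN⟩ := hC ε hε
    refine ⟨N, fun m hm n hn => ?_⟩
    rw [edist_eq_enorm_sub]
    exact le_self_add.trans_lt (hN m hm n hn)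
  obtain ⟨u, hu⟩ := cauchySeq_tendsto_of_complete hcauchy
  -- Fatou's lemma applies to the energy with measurable weight
  have henergy : Tendsto (fun n => energyQ μ d σ (f n - u : Lp ℝ 2 μ)) atTop (𝓝 0) := by
    refine ENNReal.tendsto_nhds_zero.2 fun ε hε => ?_
    have hη : 0 < (ε / (L * L)) ^ (1 / 2 : ℝ) := by
      by_cases htop : ε / (L * L) = ∞
      · simp [htop]
      · exact ENNReal.rpow_pos (ENNReal.div_pos hε.ne' (ENNReal.mul_ne_top hL hL)) htop
    obtain ⟨N, hN⟩ := hC _ hη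
    filter_upwards [eventually_ge_atTop N] with n hn
    have hlim : Tendsto (fun k => f n - f k) atTop (𝓝 (f n - u)) := tendsto_const_nhds.sub hu
    have hbound : ∀ᶠ k in atTop, energy μ (cubeWeight μ d D ν) σ (f n - f k : Lp ℝ 2 μ) ≤
        L * (ε / (L * L)) := by
      filter_upwards [eventually_ge_atTop N] with k hk
      refine (hcomp _).2.trans ?_
      gcongr
      exact ((ENNReal.rpow_lt_rpow_iff (by norm_num)).1
        (le_add_self.trans_lt (hN n hn k hk))).le
    calc energyQ μ d σ (f n - u : Lp ℝ 2 μ)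
        ≤ L * energy μ (cubeWeight μ d D ν) σ (f n - u : Lp ℝ 2 μ) := (hcomp _).1
      _ ≤ L * (L * (ε / (L * L))) := by gcongr; exact energy_le_of_tendsto hw hlim hbound
      _ = ε := by
        rw [← mul_assoc, ENNReal.mul_div_cancel (mul_ne_zero hL0 hL0) (ENNReal.mul_ne_top hL hL)]
  obtain ⟨S, hSeq⟩ := hS.exists_submodule_sobolevQ (μ := μ) hX hD hσ
  refine ⟨u, ?_, hu, ?_⟩
  · obtain ⟨n, hn⟩ := (henergy.eventually (gt_mem_nhds ENNReal.zero_lt_top)).exists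
    have h1 : f n - u ∈ S := by rw [← SetLike.mem_coe, hSeq]; exact hn
    have h2 : f n ∈ S := by rw [← SetLike.mem_coe, hSeq]; exact hf n
    rw [← hSeq, SetLike.mem_coe]
    simpa using S.sub_mem h2 h1
  · have h1 : Tendsto (fun n => ‖f n - u‖ₑ) atTop (𝓝 0) := by
      simpa [edist_eq_enorm_sub] using tendsto_iff_edist_tendsto_0.1 hu
    have h2 := henergy.ennrpow_const (1 / 2 : ℝ)
    rw [ENNReal.zero_rpow_of_pos (by norm_num)] at h2
    simpa [sobolevNorm] using h1.add h2

end HomogeneousType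

theorem theorem3p3 {X : Type*} [MeasurableSpace X] (d : X → X → ℝ) (μ : Measure X)
    (hX : HomogeneousType.IsHomogeneousType d μ)
    (hatom : ∀ x : X, μ {x} = 0) (hinf : μ Set.univ = ∞)
    (D : ℤ → Set (Set X)) (hD : HomogeneousType.IsDyadicFamily d D)
    (H : ℤ → Set X → Set (Lp ℝ 2 μ)) (hH : HomogeneousType.IsHaarSystem μ D H)
    (σ : ℝ) (hσ : 0 < σ) (l : ℝ) (hl : 0 < l) :
    (∃ C : ℝ, 0 < C ∧ ∀ u ∈ HomogeneousType.sobolevDyadic μ D σ,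
      HomogeneousType.haarProj D H l u = 0 →
        ENNReal.ofReal (C * ‖u‖ ^ 2) ≤ HomogeneousType.energyQ μ d σ u) ∧
    HomogeneousType.IsCoercivitySpace d σ
      (HomogeneousType.sobolevQ μ d σ ∩
        (HomogeneousType.sobolevDyadic μ D σ ∩ {u | HomogeneousType.haarProj D H l u = 0})) := by
  obtain ⟨κ, ν, ρ, C, hS⟩ := hD.exists_scales hX.quasiDistance
  obtain ⟨c, hc, hcoer⟩ := hS.exists_energyQ_ge hX hD hH hatom hinf hσ hl
  have hsub := hS.sobolevQ_subset_sobolevDyadic hX hσ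
  refine ⟨⟨c, hc, fun u _ hu => hcoer u hu⟩, ⟨?_, fun u hu => hu.1, ?_,
    ⟨c, hc, fun u hu => hcoer u hu.2.2⟩⟩⟩
  · obtain ⟨S, hSeq⟩ := hS.exists_submodule_sobolevQ (μ := μ) hX hD hσ
    refine ⟨S ⊓ (HomogeneousType.haarProj D H l).ker, ?_⟩
    ext u
    have hmem : u ∈ S ↔ u ∈ HomogeneousType.sobolevQ μ d σ := by rw [← hSeq, SetLike.mem_coe]
    simp only [SetLike.mem_coe, Submodule.mem_inf, hmem, Set.mem_inter_iff, Set.mem_ofPred_eq]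
    exact ⟨fun h => ⟨h.1, hsub h.1, h.2⟩, fun h => ⟨h.1, h.2.2⟩⟩
  · intro f hf hC
    obtain ⟨u, hu, hlim, hnorm⟩ := hS.exists_tendsto_sobolevNorm hX hD hσ (fun n => (hf n).1) hC
    refine ⟨u, ⟨hu, hsub hu, ?_⟩, hnorm⟩
    refine tendsto_nhds_unique
      (((HomogeneousType.haarProj D H l).continuous.tendsto u).comp hlim) ?_
    exact tendsto_const_nhds.congr fun n => (hf n).2.2.symm
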